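/- Let $\|\cdot\|$ be a norm on $\mathbb{R}^d$ with dual norm $\|\cdot\|_*$, let $\mathcal{Z}\subseteq\mathbb{R}^d$ be open and bounded, let $\mathbb{P}_{\mathrm{data}}$ be a Borel probability measure on $\mathcal{Z}$, and let $z_1,z_2,\dots$ be independent random variables with law $\mathbb{P}_{\mathrm{data}}$. Write $R(\mathbb{Q},h)=\int h\,d\mathbb{Q}$ and $\mathbb{P}_n=\frac1n\sum_{i=1}^n\delta_{z_i}$. Let $(\alpha_n)$ be a sequence of positive numbers converging to $0$, let $C_{\mathrm{H}},C_\nabla,L>0$, $k\in(0,1]$ and $p\in(1+k,\infty)$, and put $p^*=(1-1/p)^{-1}$. Let $\mathcal{H}$ be a uniformly bounded set of differentiable functions $h:\mathrm{Conv}(\mathcal{Z})\to\mathbb{R}$ such that for every $h\in\mathcal{H}$: $\|\nabla h(z)-\nabla h(\tilde z)\|_*\le C_{\mathrm{H}}\|z-\tilde z\|^k$ for all $z,\tilde z\in\mathrm{Conv}(\mathcal{Z})$, $\int\|\nabla h\|_*\,d\mathbb{P}_{\mathrm{data}}\ge C_\nabla$, and $h$ is Lipschitz with constant at most $L$. For every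 $n\ge1$ let $\hat h_n=\hat h^{\mathrm{prop}}_{\alpha_n,p}\in\mathcal{H}$ be a (data-dependent) minimizer over $h\in\mathcal{H}$ of the gradient-penalized empirical risk $$R(\mathbb{P}_n,h)+\alpha_n\Big(\int\|\nabla h\|_*^{p^*}\,d\mathbb{P}_n\Big)^{1/p^*}.$$ Then the excess risk of $\hat h_n$ satisfies $$R(\mathbb{P}_{\mathrm{data}},\hat h_n)-\inf_{h\in\mathcal{H}}R(\mathbb{P}_{\mathrm{data}},h)=O_p\big(\mathfrak{R}_n(\mathcal{H})\vee n^{-1/2}\vee\alpha_n\vee\log(n)\,\alpha_n^{1+k}\big),$$ where $\mathfrak{R}_n(\mathcal{H})=\mathbb{E}\big[\frac1n\sup_{h\in\mathcal{H}}|\sum_{i=1}^n\sigma_i h(z_i)|\big]$ is the Rademacher complexity ($\sigma_1,\dots,\sigma_n$ independent uniform signs, independent of the data), and $B_n=O_p(a_n)$ means that for every $\varepsilon>0$ there are $C$ and $n_0$ with $P(|B_n|>C a_n)<\varepsilon$ for all $n\ge n_0$. -/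

import Mathlib

open MeasureTheory ProbabilityTheory Filter Topology
open scoped NNReal ENNReal

noncomputable section

namespace WDRO

/-- `B n = O_p(a n)` for a sequence `B n : Ω → ℝ` of random quantities on `(Ω, μ)`. No measurability of
`B n` is needed: `μ` of a set that is not measurable is its outer measure. -/
def IsBigOInProbability {Ω : Type*} [MeasurableSpace Ω] (μ : Measure Ω)
    (B : ℕ → Ω → ℝ) (a : ℕ → ℝ) : Prop :=
  ∀ ε : ℝ, 0 < ε → ∃ C : ℝ, 0 < C ∧ ∃ n₀ : ℕ, ∀ n : ℕ, n₀ ≤ n →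
    μ {ω | C * a n < |B n ω|} < ENNReal.ofReal ε

section Measurable

variable {E : Type*} [MeasurableSpace E] {Z : Set E}

/-- The risk `R(Q, h) = ∫ h dQ` of a loss `h` under a measure `Q` on the sample space `Z`. Losses are written
as functions on the ambient space; only their values on the convex hull of `Z` ever matter. -/
def risk (Q : Measure Z) (h : E → ℝ) : ℝ := ∫ z : Z, h z ∂Q

/-- The empirical distribution `n⁻¹ ∑ δ_{x i}` of a sample `x` of size `n`. -/
def empirical {n : ℕ} (x : Fin n → Z) : Measure Z :=
  (n : ℝ≥0∞)⁻¹ • ∑ i : Fin n, Measure.dirac (x i)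

/-- The excess risk `R(P, g) - inf_{h ∈ H} R(P, h)`. -/
def excessRisk (P : Measure Z) (H : Set (E → ℝ)) (g : E → ℝ) : ℝ :=
  risk P g - ⨅ h : H, risk P (h : E → ℝ)

/-- The Rademacher complexity
`E_{Z_1, …, Z_n ~ P i.i.d.} E_σ ((1/n) sup_{s ∈ S} |∑ σ_i s(Z_i)|)`,
where the expectation over independent uniform signs is the average over all `2 ^ n` sign vectors. -/
def rademacher (P : Measure Z) (S : Set (E → ℝ)) (n : ℕ) : ℝ :=
  ∫ z : Fin n → Z,
    ((2 : ℝ) ^ n)⁻¹ * ∑ σ : Fin n → Bool,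
      (1 / (n : ℝ)) * ⨆ s : S, |∑ i : Fin n, (if σ i then (1 : ℝ) else -1) * (s : E → ℝ) (z i)|
    ∂(Measure.pi fun _ : Fin n => P)

end Measurable

section Gradient

variable {E : Type*} [NormedAddCommGroup E] [NormedSpace ℝ E] [MeasurableSpace E] {Z : Set E}

/-- `‖∇h‖_{Q, r} = (∫ ‖∇h(z)‖_*^r dQ(z))^{1/r}`. The gradient is the Fréchet derivative, an element of
the dual of `E`, and its operator norm is the dual norm of the norm of `E`. -/
def gradNorm (Q : Measure Z) (r : ℝ) (h : E → ℝ) : ℝ :=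
  (∫ z : Z, ‖fderiv ℝ h z‖ ^ r ∂Q) ^ (1 / r)

/-- The gradient-penalized risk `R(Q, h) + α ‖∇h‖_{Q, p*}`, with `p* = (1 - 1/p)⁻¹`. -/
def propRisk (Q : Measure Z) (α p : ℝ) (h : E → ℝ) : ℝ :=
  risk Q h + α * gradNorm Q (1 - 1 / p)⁻¹ h

end Gradient

end WDRO

end

/-!
The argument is the basic inequality of empirical risk minimization, followed by symmetrization and
Markov's inequality.

Every `h ∈ H` is `L`-Lipschitz on the open set `Z`, so the penalty `gradNorm` of a probability measure on
`Z` lies in `[0, L]` (`gradNorm_le`). Comparing the minimizer with an arbitrary competitor bounds its excess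
risk by `2 D + L α n`, where `D` is the uniform deviation between the empirical and the true risk over `H`
(`excessRisk_le`). The mean of `D` is at most twice the Rademacher complexity
(`integral_uniformDeviation_le`), so Markov's inequality makes the excess risk
`O_p(rademacher P H n ∨ α n)`, which is at least as strong as the claimed rate.

The supremum over the uncountable class `H` causes no measurability problem: all functions under it are
bounded by one constant and Lipschitz with one constant, hence the supremum is itself Lipschitz
(`UniformlyLipschitzBounded.iSup_abs`).
-/

open MeasureTheory ProbabilityTheory Filter Topology
open scoped NNReal ENNReal

noncomputable section

namespace WDRO

/-! ### Suprema of uniformly Lipschitz families -/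

section Families

variable {ι W V : Type*} [PseudoMetricSpace W] [PseudoMetricSpace V]

/-- A family of real functions with a common bound and a common Lipschitz constant. -/
def UniformlyLipschitzBounded (g : ι → W → ℝ) : Prop :=
  ∃ (M : ℝ) (K : ℝ≥0), ∀ i, (∀ w, |g i w| ≤ M) ∧ LipschitzWith K (g i)

namespace UniformlyLipschitzBounded

variable {g g' : ι → W → ℝ}

lemma comp (hg : UniformlyLipschitzBounded g) {φ : V → W} {K : ℝ≥0} (hφ : LipschitzWith K φ) :
    UniformlyLipschitzBounded fun i v => g i (φ v) := by
  obtain ⟨M, K', h⟩ := hg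
  exact ⟨M, K' * K, fun i => ⟨fun v => (h i).1 _, (h i).2.comp hφ⟩⟩

lemma add (hg : UniformlyLipschitzBounded g) (hg' : UniformlyLipschitzBounded g') :
    UniformlyLipschitzBounded fun i w => g i w + g' i w := by
  obtain ⟨M, K, h⟩ := hg
  obtain ⟨M', K', h'⟩ := hg'
  exact ⟨M + M', K + K', fun i =>
    ⟨fun w => (abs_add_le _ _).trans (add_le_add ((h i).1 w) ((h' i).1 w)), (h i).2.add (h' i).2⟩⟩

lemma const_mul (hg : UniformlyLipschitzBounded g) (c : ℝ) :
    UniformlyLipschitzBounded fun i w => c * g i w := by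
  obtain ⟨M, K, h⟩ := hg
  refine ⟨|c| * M, ‖c‖₊ * K, fun i => ⟨fun w => ?_, LipschitzWith.of_dist_le_mul fun x y => ?_⟩⟩
  · rw [abs_mul]
    exact mul_le_mul_of_nonneg_left ((h i).1 w) (abs_nonneg c)
  · have := (h i).2.dist_le_mul x y
    rw [Real.dist_eq] at this
    rw [Real.dist_eq, ← mul_sub, abs_mul, NNReal.coe_mul, coe_nnnorm, Real.norm_eq_abs, mul_assoc]
    exact mul_le_mul_of_nonneg_left this (abs_nonneg c)

lemma sub (hg : UniformlyLipschitzBounded g) (hg' : UniformlyLipschitzBounded g') :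
    UniformlyLipschitzBounded fun i w => g i w - g' i w := by
  simpa [sub_eq_add_neg] using hg.add (hg'.const_mul (-1))

lemma sum {κ : Type*} (s : Finset κ) {G : κ → ι → W → ℝ}
    (hG : ∀ j ∈ s, UniformlyLipschitzBounded (G j)) :
    UniformlyLipschitzBounded fun i w => ∑ j ∈ s, G j i w := by
  classical
  induction s using Finset.induction_on with
  | empty => exact ⟨0, 0, fun i => by simp [LipschitzWith.const']⟩
  | insert j s hj ih =>
    simp only [Finset.sum_insert hj]
    exact (hG j (by simp)).add (ih fun l hl => hG l (by simp [hl]))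

lemma weightedSum (hg : UniformlyLipschitzBounded g) {n : ℕ} (a : Fin n → ℝ) :
    UniformlyLipschitzBounded fun s (x : Fin n → W) => ∑ i, a i * g s (x i) :=
  .sum _ fun i _ => (hg.comp (LipschitzWith.eval i)).const_mul (a i)

lemma sumDiff (hg : UniformlyLipschitzBounded g) (n : ℕ) :
    UniformlyLipschitzBounded fun s (w : (Fin n → W) × (Fin n → W)) =>
      ∑ i, (g s (w.1 i) - g s (w.2 i)) :=
  .sum _ fun i _ => (hg.comp ((LipschitzWith.eval i).comp LipschitzWith.prod_fst)).sub
    (hg.comp ((LipschitzWith.eval i).comp LipschitzWith.prod_snd))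

lemma bddAbove (hg : UniformlyLipschitzBounded g) (w : W) :
    BddAbove (Set.range fun i => |g i w|) := by
  obtain ⟨M, K, h⟩ := hg
  exact ⟨M, by rintro _ ⟨i, rfl⟩; exact (h i).1 w⟩

lemma le_iSup (hg : UniformlyLipschitzBounded g) (w : W) (i : ι) : |g i w| ≤ ⨆ i, |g i w| :=
  le_ciSup (hg.bddAbove w) i

/-- The pointwise supremum of the absolute values is again bounded and Lipschitz, written as a family
with one member. -/
lemma iSup_abs [Nonempty ι] (hg : UniformlyLipschitzBounded g) :
    UniformlyLipschitzBounded fun (_ : Unit) w => ⨆ i, |g i w| := by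
  have hle := hg.le_iSup
  obtain ⟨M, K, h⟩ := hg
  refine ⟨M, K, fun _ => ⟨fun w => ?_, LipschitzWith.of_le_add_mul K fun x y => ?_⟩⟩
  · rw [abs_of_nonneg (Real.iSup_nonneg fun i => abs_nonneg _)]
    exact ciSup_le fun i => (h i).1 w
  · refine ciSup_le fun i => ?_
    have h1 := (h i).2.dist_le_mul x y
    rw [Real.dist_eq] at h1
    have h2 := abs_sub_abs_le_abs_sub (g i x) (g i y)
    linarith [hle y i]

lemma integrable [MeasurableSpace W] [OpensMeasurableSpace W] (hg : UniformlyLipschitzBounded g)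
    (Q : Measure W) [IsFiniteMeasure Q] (i : ι) : Integrable (g i) Q := by
  obtain ⟨M, K, h⟩ := hg
  exact Integrable.of_bound (h i).2.continuous.measurable.aestronglyMeasurable M
    (Eventually.of_forall (h i).1)

lemma integrable_iSup [Nonempty ι] [MeasurableSpace W] [OpensMeasurableSpace W]
    (hg : UniformlyLipschitzBounded g) (Q : Measure W) [IsFiniteMeasure Q] :
    Integrable (fun w => ⨆ i, |g i w|) Q :=
  hg.iSup_abs.integrable Q ()

end UniformlyLipschitzBounded

end Families

/-! ### Symmetrization -/

section Symmetrization

variable {T ι : Type*} [MeasurableSpace T]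

/-- Exchanging the two coordinates at the places where `σ` is `false`. -/
def swapAt {n : ℕ} (σ : Fin n → Bool) (w : (Fin n → T) × (Fin n → T)) :
    (Fin n → T) × (Fin n → T) :=
  (fun i => if σ i then w.1 i else w.2 i, fun i => if σ i then w.2 i else w.1 i)

lemma measurePreserving_swapAt (P : Measure T) [IsProbabilityMeasure P] {n : ℕ} (σ : Fin n → Bool) :
    MeasurePreserving (swapAt (T := T) σ)
      ((Measure.pi fun _ : Fin n => P).prod (Measure.pi fun _ : Fin n => P))
      ((Measure.pi fun _ : Fin n => P).prod (Measure.pi fun _ : Fin n => P)) := by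
  -- Seen in `Fin n → T × T`, the map acts coordinatewise by the identity or by `Prod.swap`.
  have he := measurePreserving_arrowProdEquivProdArrow T T (Fin n) (fun _ => P) (fun _ => P)
  have hpi : MeasurePreserving
      (fun (w : Fin n → T × T) i => (if σ i then id else Prod.swap : T × T → T × T) (w i))
      (Measure.pi fun _ : Fin n => P.prod P) (Measure.pi fun _ : Fin n => P.prod P) := by
    refine measurePreserving_pi _ _ fun i => ?_
    cases σ i
    · simpa using Measure.measurePreserving_swap (μ := P) (ν := P)
    · simpa using MeasurePreserving.id (P.prod P)
  have h := (he.comp hpi).comp (he.symm _)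
  convert h using 1
  funext w
  refine Prod.ext ?_ ?_ <;> funext i <;> by_cases hi : σ i <;>
    simp [swapAt, hi, MeasurableEquiv.arrowProdEquivProdArrow, Equiv.arrowProdEquivProdArrow]

variable [PseudoMetricSpace T] [SecondCountableTopology T] [BorelSpace T] {f : ι → T → ℝ}
  [Nonempty ι]

/-- For each fixed sign vector, the exchangeability of the sample and its ghost copy inserts the signs
into the differences, and the triangle inequality separates the two samples. -/
lemma integral_iSup_sumDiff_le (hf : UniformlyLipschitzBounded f) (P : Measure T)
    [IsProbabilityMeasure P] {n : ℕ} (σ : Fin n → Bool) :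
    ∫ w, (⨆ s, |∑ i, (f s (w.1 i) - f s (w.2 i))|)
        ∂((Measure.pi fun _ : Fin n => P).prod (Measure.pi fun _ : Fin n => P)) ≤
      2 * ∫ x, (⨆ s, |∑ i, (if σ i then (1 : ℝ) else -1) * f s (x i)|)
        ∂(Measure.pi fun _ : Fin n => P) := by
  set Q := Measure.pi fun _ : Fin n => P
  have hS := hf.sumDiff n
  have hT := hf.weightedSum fun i => if σ i then (1 : ℝ) else -1
  have hmp := measurePreserving_swapAt P σ
  have hSi := hS.integrable_iSup (Q.prod Q)
  have hTi := hT.integrable_iSup Q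
  rw [← hmp.map_eq, integral_map hmp.aemeasurable
    (by rw [hmp.map_eq]; exact hSi.aestronglyMeasurable)]
  have h1 := hTi.comp_fst Q
  have h2 := hTi.comp_snd Q
  calc _ ≤ ∫ w, ((⨆ s, |∑ i, (if σ i then (1 : ℝ) else -1) * f s (w.1 i)|) +
          ⨆ s, |∑ i, (if σ i then (1 : ℝ) else -1) * f s (w.2 i)|) ∂(Q.prod Q) := by
        refine integral_mono (hmp.integrable_comp_of_integrable hSi) (h1.add h2) fun w => ?_
        refine ciSup_le fun s => ?_
        have heq : ∑ i, (f s ((swapAt σ w).1 i) - f s ((swapAt σ w).2 i)) =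
            ∑ i, (if σ i then (1 : ℝ) else -1) * f s (w.1 i) -
              ∑ i, (if σ i then (1 : ℝ) else -1) * f s (w.2 i) := by
          rw [← Finset.sum_sub_distrib]
          refine Finset.sum_congr rfl fun i _ => ?_
          by_cases hi : σ i <;> simp [swapAt, hi]
          ring
        rw [heq]
        exact (abs_sub _ _).trans (add_le_add (hT.le_iSup w.1 s) (hT.le_iSup w.2 s))
    _ = _ := by
        rw [integral_add h1 h2, integral_fun_fst (μ := Q) (ν := Q)
            (fun x => ⨆ s, |∑ i, (if σ i then (1 : ℝ) else -1) * f s (x i)|),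
          integral_fun_snd (μ := Q) (ν := Q)
            (fun x => ⨆ s, |∑ i, (if σ i then (1 : ℝ) else -1) * f s (x i)|)]
        simp [two_mul]

/-- Jensen's inequality: the centred sum is dominated by its expected difference with a ghost sample. -/
lemma abs_sum_sub_le_integral (hf : UniformlyLipschitzBounded f) (P : Measure T)
    [IsProbabilityMeasure P] {n : ℕ} (x : Fin n → T) (s : ι) :
    |∑ i, f s (x i) - n * ∫ z, f s z ∂P| ≤
      ∫ y, (⨆ s, |∑ i, (f s (x i) - f s (y i))|) ∂(Measure.pi fun _ : Fin n => P) := by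
  have hfi := hf.integrable P s
  have hS : UniformlyLipschitzBounded fun s (y : Fin n → T) => ∑ i, (f s (x i) - f s (y i)) :=
    (hf.sumDiff n).comp (LipschitzWith.prodMk_left x)
  have heq : ∑ i, f s (x i) - n * ∫ z, f s z ∂P =
      ∫ y, (∑ i, (f s (x i) - f s (y i))) ∂(Measure.pi fun _ : Fin n => P) := by
    have hev (i : Fin n) :
        Integrable (fun y : Fin n → T => f s (y i)) (Measure.pi fun _ : Fin n => P) :=
      integrable_comp_eval (μ := fun _ : Fin n => P) hfi
    have hsub (i : Fin n) : Integrable (fun y : Fin n → T => f s (x i) - f s (y i))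
        (Measure.pi fun _ : Fin n => P) := (integrable_const _).sub (hev i)
    rw [integral_finsetSum _ fun i _ => hsub i]
    simp_rw [integral_sub (integrable_const _) (hev _),
      integral_comp_eval (μ := fun _ : Fin n => P) hfi.aestronglyMeasurable]
    simp [Finset.sum_sub_distrib]
  rw [heq]
  exact abs_integral_le_integral_abs.trans
    (integral_mono (hS.integrable _ s).abs (hS.integrable_iSup _) fun y => hS.le_iSup y s)

end Symmetrization

/-! ### Uniform deviations over a class of losses -/

section Deviation

variable {E : Type*} [MeasurableSpace E] {Z : Set E}

/-- The uniform deviation `sup_{s ∈ S} |(1/n) ∑ s(x i) - R(P, s)|` of the empirical risk. -/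
def uniformDeviation (P : Measure Z) (S : Set (E → ℝ)) {n : ℕ} (x : Fin n → Z) : ℝ :=
  ⨆ s : S, |(1 / (n : ℝ)) * ∑ i, (s : E → ℝ) (x i) - risk P (s : E → ℝ)|

lemma uniformDeviation_nonneg (P : Measure Z) (S : Set (E → ℝ)) {n : ℕ} (x : Fin n → Z) :
    0 ≤ uniformDeviation P S x :=
  Real.iSup_nonneg fun _ => abs_nonneg _

lemma isProbabilityMeasure_empirical {n : ℕ} (hn : n ≠ 0) (x : Fin n → Z) :
    IsProbabilityMeasure (empirical x) := by
  constructor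
  simp [empirical, ENNReal.inv_mul_cancel, hn]

lemma risk_empirical [MeasurableSingletonClass E] {n : ℕ} (x : Fin n → Z) (h : E → ℝ) :
    risk (empirical x) h = (1 / (n : ℝ)) * ∑ i, h (x i) := by
  unfold risk empirical
  rw [integral_smul_measure, integral_finsetSum_measure fun i _ => integrable_dirac (by simp)]
  simp

lemma abs_risk_le {P : Measure Z} [IsProbabilityMeasure P] {h : E → ℝ} {M : ℝ}
    (hM : ∀ z : Z, |h z| ≤ M) : |risk P h| ≤ M := by
  simpa [risk] using norm_integral_le_of_norm_le_const (μ := P)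
    (Eventually.of_forall fun z : Z => (Real.norm_eq_abs _).trans_le (hM z))

variable [PseudoMetricSpace E]
  {P : Measure Z} [IsProbabilityMeasure P] {S : Set (E → ℝ)}

lemma uniformlyLipschitzBounded_deviation
    (hS : UniformlyLipschitzBounded fun (s : S) (z : Z) => (s : E → ℝ) z) (n : ℕ) :
    UniformlyLipschitzBounded fun (s : S) (x : Fin n → Z) =>
      (1 / (n : ℝ)) * ∑ i, (s : E → ℝ) (x i) - risk P (s : E → ℝ) := by
  refine UniformlyLipschitzBounded.sub ?_ ?_
  · exact (UniformlyLipschitzBounded.sum _ fun i _ => hS.comp (LipschitzWith.eval i)).const_mul _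
  · obtain ⟨M, K, h⟩ := hS
    exact ⟨M, 0, fun s => ⟨fun _ => abs_risk_le (h s).1, LipschitzWith.const _⟩⟩

lemma excessRisk_nonneg (hS : UniformlyLipschitzBounded fun (s : S) (z : Z) => (s : E → ℝ) z)
    {g : E → ℝ} (hg : g ∈ S) : 0 ≤ excessRisk P S g := by
  obtain ⟨M, K, h⟩ := hS
  refine sub_nonneg.2 (ciInf_le (f := fun s : S => risk P (s : E → ℝ)) ⟨-M, ?_⟩ ⟨g, hg⟩)
  rintro _ ⟨s, rfl⟩
  exact (abs_le.1 (abs_risk_le (h s).1)).1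

variable [SecondCountableTopology E] [BorelSpace E]

/-- Symmetrization: the mean uniform deviation is at most twice the Rademacher complexity. -/
lemma integral_uniformDeviation_le [Nonempty S]
    (hS : UniformlyLipschitzBounded fun (s : S) (z : Z) => (s : E → ℝ) z) {n : ℕ} (hn : n ≠ 0) :
    ∫ x, uniformDeviation P S x ∂(Measure.pi fun _ : Fin n => P) ≤ 2 * rademacher P S n := by
  set Q := Measure.pi fun _ : Fin n => P
  have hn' : (0 : ℝ) < n := by positivity
  have hSi := (hS.sumDiff n).integrable_iSup (Q.prod Q)
  have hghost : ∫ x, uniformDeviation P S x ∂Q ≤ (1 / (n : ℝ)) *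
      ∫ w, (⨆ s : S, |∑ i, ((s : E → ℝ) (w.1 i) - (s : E → ℝ) (w.2 i))|) ∂(Q.prod Q) := by
    rw [integral_prod _ hSi, ← integral_const_mul]
    refine integral_mono ((uniformlyLipschitzBounded_deviation hS n).integrable_iSup Q)
      (hSi.integral_prod_left.const_mul _) fun x => ciSup_le fun s => ?_
    have h := abs_sum_sub_le_integral hS P x s
    have heq : (1 / (n : ℝ)) * ∑ i, (s : E → ℝ) (x i) - risk P (s : E → ℝ) =
        (1 / (n : ℝ)) * (∑ i, (s : E → ℝ) (x i) - n * ∫ z : Z, (s : E → ℝ) z ∂P) := by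
      rw [risk]; field_simp
    rw [heq, abs_mul, abs_of_pos (by positivity : (0 : ℝ) < 1 / n)]
    exact mul_le_mul_of_nonneg_left h (by positivity)
  have hint (σ : Fin n → Bool) : Integrable (fun x : Fin n → Z => (1 / (n : ℝ)) *
      ⨆ s : S, |∑ i, (if σ i then (1 : ℝ) else -1) * (s : E → ℝ) (x i)|) Q :=
    ((hS.weightedSum fun i => if σ i then (1 : ℝ) else -1).integrable_iSup Q).const_mul _
  have hrad : rademacher P S n = ((2 : ℝ) ^ n)⁻¹ * ∑ σ : Fin n → Bool, (1 / (n : ℝ)) *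
      ∫ x, (⨆ s : S, |∑ i, (if σ i then (1 : ℝ) else -1) * (s : E → ℝ) (x i)|) ∂Q := by
    rw [rademacher, integral_const_mul, integral_finsetSum _ fun σ _ => hint σ]
    simp_rw [integral_const_mul]
  refine hghost.trans ?_
  -- Average over all sign vectors the bound that holds for each of them.
  have hsum := Finset.sum_le_sum fun (σ : Fin n → Bool) (_ : σ ∈ Finset.univ) =>
    mul_le_mul_of_nonneg_left (integral_iSup_sumDiff_le hS P σ) (by positivity : 0 ≤ 1 / (n : ℝ))
  rw [Finset.sum_const, nsmul_eq_mul, Finset.card_univ, Fintype.card_fun,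
    Fintype.card_bool, Fintype.card_fin, Nat.cast_pow, Nat.cast_ofNat] at hsum
  simp_rw [mul_left_comm (1 / (n : ℝ)) 2] at hsum
  rw [← Finset.mul_sum] at hsum
  rw [hrad, mul_left_comm]
  exact (le_inv_mul_iff₀ (by positivity)).2 hsum

/-- The uniform deviation of an i.i.d. sample, through Markov's inequality. No measurability is lost, as
the uniform deviation is a continuous function of the sample. -/
lemma measure_le_uniformDeviation_le [Nonempty S]
    (hS : UniformlyLipschitzBounded fun (s : S) (z : Z) => (s : E → ℝ) z)
    {Ω : Type*} [MeasurableSpace Ω] {μ : Measure Ω} [IsProbabilityMeasure μ]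
    {X : ℕ → Ω → Z} (hX_meas : ∀ i, Measurable (X i)) (hX_indep : iIndepFun X μ)
    (hX_law : ∀ i, μ.map (X i) = P) {n : ℕ} (hn : n ≠ 0) {t : ℝ} (ht : 0 < t) :
    μ {ω | t ≤ uniformDeviation P S fun i : Fin n => X i ω} ≤
      ENNReal.ofReal (2 * rademacher P S n / t) := by
  have hD := uniformlyLipschitzBounded_deviation (P := P) hS n
  have hlaw : μ.map (fun ω (i : Fin n) => X i ω) = Measure.pi fun _ : Fin n => P := by
    have h := (iIndepFun_iff_map_fun_eq_pi_map
      (fun i : Fin n => (hX_meas i).aemeasurable)).1 (hX_indep.precomp Fin.val_injective)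
    simpa [hX_law] using h
  have hmeas : Measurable fun ω (i : Fin n) => X i ω := measurable_pi_lambda _ fun i => hX_meas i
  have hset : MeasurableSet {x : Fin n → Z | t ≤ uniformDeviation P S x} := by
    obtain ⟨M, K, h⟩ := hD.iSup_abs
    exact measurableSet_le measurable_const (h ()).2.continuous.measurable
  have hmarkov := mul_meas_ge_le_integral_of_nonneg
    (Eventually.of_forall fun x => uniformDeviation_nonneg P S x)
    (hD.integrable_iSup (Measure.pi fun _ : Fin n => P)) t
  have hpre : μ {ω | t ≤ uniformDeviation P S fun i : Fin n => X i ω} =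
      (Measure.pi fun _ : Fin n => P) {x | t ≤ uniformDeviation P S x} := by
    rw [← hlaw, Measure.map_apply hmeas hset]
    rfl
  rw [hpre, ← ENNReal.ofReal_toReal (measure_ne_top _ _)]
  refine ENNReal.ofReal_le_ofReal ?_
  rw [le_div_iff₀ ht, mul_comm]
  exact hmarkov.trans (integral_uniformDeviation_le hS hn)

end Deviation

/-! ### The basic inequality for the penalized minimizer -/

section Penalty

variable {E : Type*} [NormedAddCommGroup E] [NormedSpace ℝ E] [MeasurableSpace E] {Z : Set E}

lemma gradNorm_nonneg (Q : Measure Z) (r : ℝ) (h : E → ℝ) : 0 ≤ gradNorm Q r h :=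
  Real.rpow_nonneg (integral_nonneg fun _ => Real.rpow_nonneg (norm_nonneg _) _) _

lemma gradNorm_le (hZ : IsOpen Z) (Q : Measure Z) [IsProbabilityMeasure Q] {r : ℝ} (hr : 0 < r)
    {L : ℝ≥0} {h : E → ℝ} (hL : LipschitzOnWith L h Z) : gradNorm Q r h ≤ L := by
  have hbound (z : Z) : ‖‖fderiv ℝ h z‖ ^ r‖ ≤ (L : ℝ) ^ r := by
    rw [Real.norm_of_nonneg (by positivity)]
    exact Real.rpow_le_rpow (norm_nonneg _)
      (norm_fderiv_le_of_lipschitzOn ℝ (hZ.mem_nhds z.2) hL) hr.le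
  have hint : ∫ z : Z, ‖fderiv ℝ h z‖ ^ r ∂Q ≤ (L : ℝ) ^ r := by
    simpa using (le_abs_self _).trans
      (norm_integral_le_of_norm_le_const (μ := Q) (Eventually.of_forall hbound))
  calc gradNorm Q r h ≤ ((L : ℝ) ^ r) ^ (1 / r) :=
        Real.rpow_le_rpow (integral_nonneg fun _ => by positivity) hint (by positivity)
    _ = L := by rw [one_div, Real.rpow_rpow_inv L.coe_nonneg hr.ne']

variable [SecondCountableTopology E] [BorelSpace E] {P : Measure Z} [IsProbabilityMeasure P]
  {S : Set (E → ℝ)}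

/-- The excess risk of a minimizer of the penalized empirical risk is at most twice the uniform
deviation plus the largest possible penalty. -/
lemma excessRisk_le (hZ : IsOpen Z)
    (hS : UniformlyLipschitzBounded fun (s : S) (z : Z) => (s : E → ℝ) z) {L : ℝ≥0}
    (hL : ∀ s ∈ S, LipschitzOnWith L s Z) {a p : ℝ} (ha : 0 ≤ a) (hp : 1 < p) {n : ℕ} (hn : n ≠ 0)
    (x : Fin n → Z) {g : E → ℝ} (hg : g ∈ S)
    (hmin : ∀ h ∈ S, propRisk (empirical x) a p g ≤ propRisk (empirical x) a p h) :
    excessRisk P S g ≤ 2 * uniformDeviation P S x + a * L := by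
  have : Nonempty S := ⟨⟨g, hg⟩⟩
  have := isProbabilityMeasure_empirical hn x
  have hr : 0 < (1 - 1 / p)⁻¹ := by
    have : 1 / p < 1 := (div_lt_one (by linarith)).2 hp
    exact inv_pos.2 (by linarith)
  rw [excessRisk, sub_le_comm]
  refine le_ciInf fun s => ?_
  have hdev (s : S) := abs_le.1
    ((uniformlyLipschitzBounded_deviation (P := P) hS n).le_iSup x s)
  have h := hmin s s.2
  simp only [propRisk, risk_empirical] at h
  have h1 := mul_nonneg ha (gradNorm_nonneg (empirical x) (1 - 1 / p)⁻¹ g)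
  have h2 := mul_le_mul_of_nonneg_left (gradNorm_le hZ (empirical x) hr (hL s s.2)) ha
  have h3 := (hdev ⟨g, hg⟩).1
  have h4 := (hdev s).2
  simp only [uniformDeviation] at *
  linarith

end Penalty

end WDRO

end

theorem theorem3
    -- `ℝ^d` with an arbitrary norm
    {E : Type*} [NormedAddCommGroup E] [NormedSpace ℝ E] [FiniteDimensional ℝ E]
    [MeasurableSpace E] [BorelSpace E]
    -- the sample space and the data distribution
    (Z : Set E) (hZ_open : IsOpen Z) (hZ_bdd : Bornology.IsBounded Z)
    (P : Measure Z) [IsProbabilityMeasure P]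
    -- the radii
    (α : ℕ → ℝ) (hα_pos : ∀ n, 0 < α n) (hα_lim : Tendsto α atTop (𝓝 0))
    -- the constants
    (CH L k : ℝ≥0) (Cgrad p : ℝ) (hCH : 0 < CH) (hL : 0 < L) (hCgrad : 0 < Cgrad)
    (hk_pos : 0 < k) (hk_le : k ≤ 1) (hp : 1 + (k : ℝ) < p)
    -- the class of losses
    (H : Set (E → ℝ))
    (hH_bdd : ∃ M : ℝ, ∀ h ∈ H, ∀ z ∈ convexHull ℝ Z, |h z| ≤ M)
    (hH_diff : ∀ h ∈ H, DifferentiableOn ℝ h (convexHull ℝ Z))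
    (hH_holder : ∀ h ∈ H, HolderOnWith CH k (fderiv ℝ h) (convexHull ℝ Z))
    (hH_grad : ∀ h ∈ H, Cgrad ≤ ∫ z : Z, ‖fderiv ℝ h z‖ ∂P)
    (hH_lip : ∀ h ∈ H, LipschitzOnWith L h (convexHull ℝ Z))
    -- the data: an i.i.d. sequence with law `P`
    {Ω : Type*} [MeasurableSpace Ω] (μ : Measure Ω) [IsProbabilityMeasure μ]
    (X : ℕ → Ω → Z) (hX_meas : ∀ i, Measurable (X i)) (hX_indep : iIndepFun X μ)
    (hX_law : ∀ i, μ.map (X i) = P)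
    -- a minimizer of the gradient-penalized empirical risk for every sample size
    (hhat : ℕ → Ω → E → ℝ)
    (hhat_min : ∀ n : ℕ, 1 ≤ n → ∀ᵐ ω ∂μ, hhat n ω ∈ H ∧
      ∀ h ∈ H, WDRO.propRisk (WDRO.empirical fun i : Fin n => X i ω) (α n) p (hhat n ω) ≤
        WDRO.propRisk (WDRO.empirical fun i : Fin n => X i ω) (α n) p h) :
    WDRO.IsBigOInProbability μ (fun n ω => WDRO.excessRisk P H (hhat n ω))
      (fun n => max (WDRO.rademacher P H n) (max ((n : ℝ) ^ (-(1 / 2) : ℝ))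
        (max (α n) (Real.log n * α n ^ (1 + (k : ℝ)))))) := by

  have : SecondCountableTopology E := by
    have := FiniteDimensional.proper ℝ E
    infer_instance
  have hsub : Z ⊆ convexHull ℝ Z := subset_convexHull ℝ Z
  have hLip : ∀ h ∈ H, LipschitzOnWith L h Z := fun h hh => (hH_lip h hh).mono hsub
  have hfam : WDRO.UniformlyLipschitzBounded fun (h : H) (z : Z) => (h : E → ℝ) z := by
    obtain ⟨M, hM⟩ := hH_bdd
    exact ⟨M, L, fun h => ⟨fun z => hM h h.2 z (hsub z.2), (hLip h h.2).to_restrict⟩⟩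
  have : Nonempty H := by
    obtain ⟨ω, hω⟩ := (hhat_min 1 le_rfl).exists
    exact ⟨⟨hhat 1 ω, hω.1⟩⟩
  intro ε hε
  -- The part `L` of the constant absorbs the penalty; the part `8 / ε` makes Markov's bound `ε / 2`.
  refine ⟨L + 8 / ε, by positivity, 1, fun n hn => ?_⟩
  have hn0 : n ≠ 0 := by omega
  set A := max (WDRO.rademacher P H n) (max ((n : ℝ) ^ (-(1 / 2) : ℝ))
    (max (α n) (Real.log n * α n ^ (1 + (k : ℝ)))))
  have hAα : α n ≤ A := (le_max_left _ _).trans ((le_max_right _ _).trans (le_max_right _ _))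
  have hAR : WDRO.rademacher P H n ≤ A := le_max_left _ _
  have hA : 0 < A := (hα_pos n).trans_le hAα
  have ht : 0 < 4 / ε * A := by positivity
  have hincl : {ω | ((L : ℝ) + 8 / ε) * A < |WDRO.excessRisk P H (hhat n ω)|} ≤ᵐ[μ]
      {ω | 4 / ε * A ≤ WDRO.uniformDeviation P H fun i : Fin n => X i ω} := by
    filter_upwards [hhat_min n hn] with ω hω hlt
    have hlt' : ((L : ℝ) + 8 / ε) * A < |WDRO.excessRisk P H (hhat n ω)| := hlt
    change 4 / ε * A ≤ _
    have hle := WDRO.excessRisk_le (P := P) hZ_open hfam hLip (hα_pos n).le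
      (by linarith [show (0 : ℝ) < k from hk_pos]) hn0 _ hω.1 hω.2
    rw [abs_of_nonneg (WDRO.excessRisk_nonneg hfam hω.1)] at hlt'
    have hαL := mul_le_mul_of_nonneg_right hAα L.coe_nonneg
    have h8 : 8 / ε * A = 2 * (4 / ε * A) := by ring
    linarith
  refine (measure_mono_ae hincl).trans_lt
    ((WDRO.measure_le_uniformDeviation_le hfam hX_meas hX_indep hX_law hn0 ht).trans_lt ?_)
  refine (ENNReal.ofReal_lt_ofReal_iff hε).2 ?_
  rw [div_lt_iff₀ ht]
  have h4 : ε * (4 / ε * A) = 4 * A := by field_simp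
  linarith
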